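/- Let $n = qd$ with integers $q, d$, let $p$ be a nonnegative integer and let $C \in \mathbb{R}^{n\times n}$ be symmetric. Write $\langle A, B\rangle = \operatorname{trace}(A^\top B)$. For $X\in\mathbb{R}^{n\times n}$ let $\mathrm{bd}(X)$ be the matrix obtained from $X$ by keeping the $q$ consecutive diagonal blocks of size $d\times d$ and setting all other entries to zero. The Orthogonal-Cut SDP is $$\min_{X = X^\top \in \mathbb{R}^{n\times n}} \langle C, X\rangle \quad\text{subject to}\quad \mathrm{bd}(X) = I_n,\ X \succeq 0,$$ and its Burer--Monteiro factorization is $$\min_{Y\in\mathbb{R}^{n\times p}} g(Y) = \langle CY, Y\rangle \quad\text{subject to}\quad Y \in \mathcal{M} = \{Y \in \mathbb{R}^{n\times p} : \mathrm{bd}(YY^\top) = I_n\}.$$ The tangent space of $\mathcal{M}$ at $Y$ is $T_Y = \{\dot Y \in \mathbb{R}^{n\times p} : \mathrm{bd}(\dot Y Y^\top + Y\dot Y^\top) = 0\}$; let $\mathrm{Proj}_Y$ be the orthogonal projector onto $T_Y$ for $\langle\cdot,\cdot\rangle$. The Riemannian gradient of $g$ is $\operatorname{grad} g(Y) = \mathrm{Proj}_Y(\nabla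 g(Y))$ and the Riemannian Hessian is $\operatorname{Hess} g(Y)[\dot Y] = \mathrm{Proj}_Y(\mathrm{D}\operatorname{grad} g(Y)[\dot Y])$ for $\dot Y\in T_Y$. A point $Y\in\mathcal{M}$ is a second-order critical point if $\operatorname{grad} g(Y) = 0$ and $\langle \dot Y, \operatorname{Hess} g(Y)[\dot Y]\rangle \ge 0$ for all $\dot Y\in T_Y$. If $p > \frac{d+1}{d+3}\,n$, then, for every symmetric $C$, every second-order critical point $Y$ of the factorized problem is globally optimal for it, and $X = YY^\top$ is globally optimal for the Orthogonal-Cut SDP. In particular, for the Max-Cut SDP (the case $d = 1$, in which the constraint $\mathrm{bd}(X) = I_n$ reads $\operatorname{diag}(X) = (1,\dots,1)^\top$, and $\mathrm{bd}$ is replaced by $\operatorname{diag}$ throughout) the same conclusion holds whenever $p > n/2$. -/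

import Mathlib

open scoped Matrix

/-! ### The Frobenius inner product on real matrices -/

attribute [local instance] Matrix.frobeniusNormedAddCommGroup Matrix.frobeniusNormedSpace

/-- The Euclidean inner product `⟨A, B⟩ = trace (Aᵀ B)` on real matrices; its norm is Mathlib's
Frobenius norm. -/
@[reducible]
noncomputable def frobeniusInnerProductSpace (m k : Type*) [Fintype m] [Fintype k] :
    InnerProductSpace ℝ (Matrix m k ℝ) where
  inner A B := (Aᵀ * B).trace
  norm_sq_eq_re_inner A := by
    rw [Matrix.frobenius_norm_def, ← Real.rpow_natCast, ← Real.rpow_mul (by positivity)]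
    simp only [Matrix.trace, Matrix.diag, Matrix.mul_apply, Matrix.transpose_apply]
    rw [Finset.sum_comm]
    simp [pow_two]
  conj_inner_symm A B := by
    rw [← Matrix.trace_transpose]
    simp
  add_left A B D := by simp [Matrix.add_mul]
  smul_left A B r := by simp

attribute [local instance] frobeniusInnerProductSpace

/-! ### Riemannian first- and second-order objects on a level set -/

section LevelSet

variable {E F : Type*} [NormedAddCommGroup E] [InnerProductSpace ℝ E] [FiniteDimensional ℝ E]
  [CompleteSpace E] [NormedAddCommGroup F] [NormedSpace ℝ F]

/-- The tangent space at `y` to the level set of `h` through `y`: the kernel of `D h(y)`. -/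
noncomputable def tangentSpaceAt (h : E → F) (y : E) : Submodule ℝ E :=
  LinearMap.ker (fderiv ℝ h y : E →ₗ[ℝ] F)

/-- The Riemannian gradient: the orthogonal projection of the Euclidean gradient of `g` onto the
tangent space. -/
noncomputable def riemannianGrad (h : E → F) (g : E → ℝ) (y : E) : E :=
  (tangentSpaceAt h y).starProjection (gradient g y)

/-- The Riemannian Hessian `v ↦ Proj_y (D grad g (y)[v])`: the orthogonal projection onto the tangent
space of the Fréchet derivative of the Riemannian gradient vector field. -/
noncomputable def riemannianHess (h : E → F) (g : E → ℝ) (y v : E) : E :=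
  (tangentSpaceAt h y).starProjection (fderiv ℝ (riemannianGrad h g) y v)

end LevelSet

/-! ### Semidefinite programs and their Burer–Monteiro factorizations -/

section SDP

variable {n p : ℕ} {V : Type*} [NormedAddCommGroup V] [NormedSpace ℝ V]

/-- The search space `{X : 𝒜(X) = b, X ⪰ 0}` of the SDP (`PosSemidef` includes symmetry). -/
def sdpFeasible (𝒜 : Matrix (Fin n) (Fin n) ℝ →ₗ[ℝ] V) (b : V) : Set (Matrix (Fin n) (Fin n) ℝ) :=
  {X | 𝒜 X = b ∧ X.PosSemidef}

/-- `X` is globally optimal for `min ⟨C, X⟩` subject to `𝒜(X) = b`, `X ⪰ 0`. -/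
def IsSDPOptimal (𝒜 : Matrix (Fin n) (Fin n) ℝ →ₗ[ℝ] V) (b : V) (C X : Matrix (Fin n) (Fin n) ℝ) :
    Prop :=
  X ∈ sdpFeasible 𝒜 b ∧ IsMinOn (fun X' => inner ℝ C X') (sdpFeasible 𝒜 b) X

/-- The map `Y ↦ 𝒜(Y Yᵀ)` defining the constraints of the factorized problem. -/
def bmConstraint (p : ℕ) (𝒜 : Matrix (Fin n) (Fin n) ℝ →ₗ[ℝ] V) (Y : Matrix (Fin n) (Fin p) ℝ) : V :=
  𝒜 (Y * Yᵀ)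

/-- The search space `ℳ = {Y ∈ ℝⁿˣᵖ : 𝒜(Y Yᵀ) = b}` of the factorized problem. -/
def bmFeasible (p : ℕ) (𝒜 : Matrix (Fin n) (Fin n) ℝ →ₗ[ℝ] V) (b : V) :
    Set (Matrix (Fin n) (Fin p) ℝ) :=
  {Y | bmConstraint p 𝒜 Y = b}

/-- The cost `g(Y) = ⟨C Y, Y⟩`. -/
noncomputable def bmCost (p : ℕ) (C : Matrix (Fin n) (Fin n) ℝ) (Y : Matrix (Fin n) (Fin p) ℝ) : ℝ :=
  inner ℝ (C * Y) Y

/-- `Y` is globally optimal for `min ⟨C Y, Y⟩` subject to `𝒜(Y Yᵀ) = b`. -/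
def IsBMOptimal (𝒜 : Matrix (Fin n) (Fin n) ℝ →ₗ[ℝ] V) (b : V) (C : Matrix (Fin n) (Fin n) ℝ)
    (Y : Matrix (Fin n) (Fin p) ℝ) : Prop :=
  Y ∈ bmFeasible p 𝒜 b ∧ IsMinOn (bmCost p C) (bmFeasible p 𝒜 b) Y

/-- `Y ∈ ℳ` is a second-order critical point: the Riemannian gradient of the cost vanishes at `Y` and
the Riemannian Hessian is positive semidefinite on the tangent space at `Y`. -/
def IsSecondOrderCritical (𝒜 : Matrix (Fin n) (Fin n) ℝ →ₗ[ℝ] V) (b : V)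
    (C : Matrix (Fin n) (Fin n) ℝ) (Y : Matrix (Fin n) (Fin p) ℝ) : Prop :=
  Y ∈ bmFeasible p 𝒜 b ∧
  riemannianGrad (bmConstraint p 𝒜) (bmCost p C) Y = 0 ∧
  ∀ Ydot ∈ tangentSpaceAt (bmConstraint p 𝒜) Y,
    0 ≤ inner ℝ Ydot (riemannianHess (bmConstraint p 𝒜) (bmCost p C) Y Ydot)

end SDP

/-! ### The Orthogonal-Cut and Max-Cut constraints -/

/-- The operator that keeps the consecutive diagonal blocks of size `d × d` and zeros out all other
entries: with 0-based indices, row `i` lies in block `i / d`. -/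
def blockDiagPart (n d : ℕ) : Matrix (Fin n) (Fin n) ℝ →ₗ[ℝ] Matrix (Fin n) (Fin n) ℝ where
  toFun X := Matrix.of fun i j => if (i : ℕ) / d = (j : ℕ) / d then X i j else 0
  map_add' X X' := by
    ext i j
    by_cases h : (i : ℕ) / d = (j : ℕ) / d <;> simp [h]
  map_smul' r X := by
    ext i j
    by_cases h : (i : ℕ) / d = (j : ℕ) / d <;> simp [h]

/-!
At a critical point `Y` the first-order condition yields a Lagrange multiplier: a symmetric block
diagonal `Λ` such that `S = C + Cᵀ - Λ` satisfies `S Y = 0`. The Hessian is then `v ↦ ⟨v, S v⟩` on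
tangent vectors, and by weak duality everything follows once `S` is positive semidefinite.

Given `u`, the sign of `uᵀ S u` is read off a tangent vector `v = u zᵀ - Y B` with `z ≠ 0`,
because `S Y = 0` gives `⟨v, S v⟩ = (uᵀ S u) ‖z‖²`. If `Y z = 0` for some `z ≠ 0`, then `B = 0`
will do. Otherwise `Y` has rank `p`, and tangency of `v` imposes on `z` as many linear conditions
as there are independent relations `Yᵀ Λ Y = 0` with `Λ` symmetric and block diagonal, so it is
enough that there are fewer than `p` of them. A single block of orthonormal rows has no
relations. Adding the blocks one at a time, a block whose row span meets the span of the earlier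
rows in dimension `r ≤ d` creates at most `r (r + 1) / 2 ≤ (d + 1) r / 2` relations, and the rank
grows by `r` less than the number of rows added. In total there are at most `(d + 1) (n - p) / 2`
relations, and this is less than `p` exactly when `(d + 1) n < (d + 3) p`.
-/

section Frobenius

variable {l m k : Type*} [Fintype l] [Fintype m] [Fintype k]

theorem frobenius_inner_eq_sum (A B : Matrix m k ℝ) : inner ℝ A B = ∑ i, ∑ j, A i j * B i j := by
  rw [Finset.sum_comm]
  rfl

theorem frobenius_inner_mul_left (A : Matrix m l ℝ) (B : Matrix l k ℝ) (D : Matrix m k ℝ) :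
    inner ℝ (A * B) D = inner ℝ A (D * Bᵀ) := by
  change ((A * B)ᵀ * D).trace = (Aᵀ * (D * Bᵀ)).trace
  rw [Matrix.transpose_mul, Matrix.mul_assoc, Matrix.trace_mul_comm, Matrix.mul_assoc]

theorem frobenius_inner_mul_right (A : Matrix m l ℝ) (B : Matrix l k ℝ) (D : Matrix m k ℝ) :
    inner ℝ (A * B) D = inner ℝ B (Aᵀ * D) := by
  change ((A * B)ᵀ * D).trace = (Bᵀ * (Aᵀ * D)).trace
  rw [Matrix.transpose_mul, Matrix.mul_assoc]

theorem frobenius_inner_transpose (A B : Matrix m k ℝ) : inner ℝ Aᵀ Bᵀ = inner ℝ A B := by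
  rw [frobenius_inner_eq_sum, frobenius_inner_eq_sum, Finset.sum_comm]
  rfl

theorem frobenius_inner_vecMulVec_mul (S : Matrix m m ℝ) (u : m → ℝ) (z : k → ℝ) :
    inner ℝ (Matrix.vecMulVec u z) (S * Matrix.vecMulVec u z) = (u ⬝ᵥ S *ᵥ u) * (z ⬝ᵥ z) := by
  rw [Matrix.mul_vecMulVec, frobenius_inner_eq_sum, dotProduct, dotProduct, Finset.sum_mul_sum]
  refine Finset.sum_congr rfl fun i _ => Finset.sum_congr rfl fun j _ => ?_
  rw [Matrix.vecMulVec_apply, Matrix.vecMulVec_apply]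
  ring

theorem frobenius_inner_nonneg_of_posSemidef {S X : Matrix m m ℝ} (hS : S.PosSemidef)
    (hX : X.PosSemidef) : 0 ≤ inner ℝ S X := by
  have h := (hS.hadamard hX).dotProduct_mulVec_nonneg 1
  rw [frobenius_inner_eq_sum]
  simpa [Matrix.mulVec, dotProduct] using h

end Frobenius

section QuadraticMaps

variable {E F : Type*} [NormedAddCommGroup E] [InnerProductSpace ℝ E] [FiniteDimensional ℝ E]
  [NormedAddCommGroup F] [NormedSpace ℝ F]

theorem mem_tangentSpaceAt_of_quadratic {h : E → F} (b : E →ₗ[ℝ] E →ₗ[ℝ] F)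
    (hb : ∀ y, h y = b y y) (y v : E) : v ∈ tangentSpaceAt h y ↔ b y v + b v y = 0 := by
  have h_deriv : HasFDerivAt (fun y => b y y) _ y :=
    b.toContinuousBilinearMap.hasFDerivAt_of_bilinear (hasFDerivAt_id y) (hasFDerivAt_id y)
  rw [tangentSpaceAt, funext hb, h_deriv.fderiv]
  rfl

theorem gradient_of_quadratic [CompleteSpace E] {g : E → ℝ} (T T' : E →ₗ[ℝ] E)
    (hT : ∀ x y, inner ℝ (T x) y = inner ℝ x (T' y)) (hg : ∀ y, g y = inner ℝ (T y) y) (y : E) :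
    gradient g y = T y + T' y := by
  refine HasGradientAt.gradient ?_
  rw [hasGradientAt_iff_hasFDerivAt, funext hg]
  have h_deriv : HasFDerivAt (fun y => inner ℝ (T y) y) _ y :=
    ((LinearMap.toContinuousLinearMap T).hasFDerivAt (x := y)).inner ℝ (hasFDerivAt_id y)
  refine h_deriv.congr_fderiv ?_
  ext v
  change inner ℝ (T y) v + inner ℝ (T v) y = inner ℝ (T y + T' y) v
  rw [hT v, inner_add_left, real_inner_comm (T' y)]

end QuadraticMaps

section LagrangeMultiplier

open ContinuousLinearMap Topology

variable {E F N : Type*} [NormedAddCommGroup E] [InnerProductSpace ℝ E] [CompleteSpace E]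
  [NormedAddCommGroup F] [NormedSpace ℝ F]
  [NormedAddCommGroup N] [InnerProductSpace ℝ N] [CompleteSpace N]

/-- The Gram operator `K(y)* K(y)` of the normal vectors `K(y) Λ`. -/
noncomputable def normalGram (K : E → N →L[ℝ] E) (y : E) : N →L[ℝ] N :=
  adjoint (K y) ∘L K y

/-- The least-squares Lagrange multiplier of `g` at `y`: if the normal space at `y` is parametrized
injectively by `K y`, it is the parameter of the normal component of the gradient of `g`. -/
noncomputable def lagrangeMultiplier (K : E → N →L[ℝ] E) (g : E → ℝ) (y : E) : N :=
  Ring.inverse (normalGram K y) (adjoint (K y) (gradient g y))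

theorem isUnit_normalGram [FiniteDimensional ℝ N] {K : E → N →L[ℝ] E} {y : E}
    (hK : Function.Injective (K y)) : IsUnit (normalGram K y) := by
  have hker : LinearMap.ker (normalGram K y).toLinearMap = ⊥ := by
    rw [normalGram, ker_adjoint_comp_self]
    exact LinearMap.ker_eq_bot.2 hK
  exact ContinuousLinearMap.isUnit_iff_bijective.2
    ⟨LinearMap.ker_eq_bot.1 hker, LinearMap.surjective_of_injective (LinearMap.ker_eq_bot.1 hker)⟩

theorem gradient_sub_lagrangeMultiplier_mem_orthogonal {K : E → N →L[ℝ] E} {g : E → ℝ} {y : E}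
    (hK : IsUnit (normalGram K y)) :
    gradient g y - K y (lagrangeMultiplier K g y) ∈ (K y).rangeᗮ := by
  have normal_equation : normalGram K y (lagrangeMultiplier K g y) = adjoint (K y) (gradient g y) :=
    DFunLike.congr_fun (Ring.mul_inverse_cancel _ hK) (adjoint (K y) (gradient g y))
  rw [orthogonal_range, LinearMap.mem_ker]
  change adjoint (K y) (_ - _) = 0
  rw [map_sub, ← normal_equation]
  exact sub_self _

theorem riemannianGrad_eq_gradient_sub [FiniteDimensional ℝ E] {h : E → F} {K : E → N →L[ℝ] E}
    {y : E} (hT : tangentSpaceAt h y = (K y).rangeᗮ) (hK : IsUnit (normalGram K y)) (g : E → ℝ) :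
    riemannianGrad h g y = gradient g y - K y (lagrangeMultiplier K g y) := by
  refine Submodule.eq_starProjection_of_mem_of_inner_eq_zero ?_ fun v hv => ?_
  · rw [hT]
    exact gradient_sub_lagrangeMultiplier_mem_orthogonal hK
  · rw [hT] at hv
    rw [sub_sub_cancel]
    exact Submodule.inner_right_of_mem_orthogonal (LinearMap.mem_range_self _ _) hv

theorem differentiable_adjoint : Differentiable ℝ (adjoint : (N →L[ℝ] E) → (E →L[ℝ] N)) :=
  (IsBoundedLinearMap.mk (𝕜 := ℝ) ⟨map_add _, fun r A => by simp⟩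
    ⟨1, one_pos, fun A => by simp⟩).differentiable

theorem differentiableAt_normalGram {K : E → N →L[ℝ] E} {y : E} (hK : DifferentiableAt ℝ K y) :
    DifferentiableAt ℝ (normalGram K) y :=
  ((differentiable_adjoint _).comp y hK).clm_comp hK

theorem differentiableAt_lagrangeMultiplier {K : E → N →L[ℝ] E} {g : E → ℝ} {y : E}
    (hK : DifferentiableAt ℝ K y) (hg : DifferentiableAt ℝ (gradient g) y)
    (hy : IsUnit (normalGram K y)) : DifferentiableAt ℝ (lagrangeMultiplier K g) y :=
  ((differentiableAt_inverse hy).comp y (differentiableAt_normalGram hK)).clm_apply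
    (((differentiable_adjoint _).comp y hK).clm_apply hg)

theorem inner_riemannianHess_eq [FiniteDimensional ℝ E] [FiniteDimensional ℝ N] {h : E → F}
    {K : E → N →L[ℝ] E} (hT : ∀ y, tangentSpaceAt h y = (K y).rangeᗮ) {g : E → ℝ} {y : E}
    (hK : DifferentiableAt ℝ K y) (hg : DifferentiableAt ℝ (gradient g) y)
    (hy : Function.Injective (K y)) {v : E} (hv : v ∈ tangentSpaceAt h y) :
    inner ℝ v (riemannianHess h g y v) =
      inner ℝ v (fderiv ℝ (gradient g) y v - fderiv ℝ K y v (lagrangeMultiplier K g y)) := by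
  have hunit := isUnit_normalGram hy
  have hgrad : riemannianGrad h g =ᶠ[𝓝 y]
      fun x => gradient g x - K x (lagrangeMultiplier K g x) := by
    filter_upwards [(differentiableAt_normalGram hK).continuousAt.eventually
      (Units.isOpen.mem_nhds hunit)] with x hx
    exact riemannianGrad_eq_gradient_sub (hT x) hx g
  have h_deriv := hg.hasFDerivAt.fun_sub
    (hK.hasFDerivAt.clm_apply (differentiableAt_lagrangeMultiplier hK hg hunit).hasFDerivAt)
  have h_fderiv : fderiv ℝ (riemannianGrad h g) y v = fderiv ℝ (gradient g) y v -
      (K y (fderiv ℝ (lagrangeMultiplier K g) y v) +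
        fderiv ℝ K y v (lagrangeMultiplier K g y)) := by
    rw [hgrad.fderiv_eq, h_deriv.fderiv]
    rfl
  have hnormal : inner ℝ v (K y (fderiv ℝ (lagrangeMultiplier K g) y v)) = 0 :=
    Submodule.inner_left_of_mem_orthogonal (LinearMap.mem_range_self _ _) (hT y ▸ hv)
  rw [riemannianHess, ← Submodule.inner_starProjection_left_eq_right,
    Submodule.starProjection_eq_self_iff.2 hv, h_fderiv, add_comm, ← sub_sub,
    inner_sub_right _ _ (K y _), hnormal, sub_zero]

theorem exists_multiplier_of_riemannianGrad_eq_zero [FiniteDimensional ℝ E]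
    [FiniteDimensional ℝ N] {h : E → F} {g : E → ℝ} (K : E →ₗ[ℝ] N →ₗ[ℝ] E) (G : E →ₗ[ℝ] E)
    (hK : ∀ y v, v ∈ tangentSpaceAt h y ↔ ∀ Λ, inner ℝ (K y Λ) v = 0)
    (hG : ∀ y, gradient g y = G y) {y : E} (hy : Function.Injective (K y))
    (hgrad : riemannianGrad h g y = 0) :
    ∃ Λ, G y = K y Λ ∧ ∀ v ∈ tangentSpaceAt h y,
      inner ℝ v (riemannianHess h g y v) = inner ℝ v (G v - K v Λ) := by
  have hT : ∀ y, tangentSpaceAt h y = (K.toContinuousBilinearMap y).rangeᗮ := fun y => by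
    ext v
    simp only [hK, Submodule.mem_orthogonal, LinearMap.mem_range, forall_exists_index,
      forall_apply_eq_imp_iff]
    rfl
  have hG' : gradient g = LinearMap.toContinuousLinearMap G := funext hG
  refine ⟨lagrangeMultiplier K.toContinuousBilinearMap g y, ?_, fun v hv => ?_⟩
  · rw [← hG, ← sub_eq_zero, ← hgrad]
    exact (riemannianGrad_eq_gradient_sub (hT y) (isUnit_normalGram hy) g).symm
  · rw [inner_riemannianHess_eq hT K.toContinuousBilinearMap.differentiableAt
      (hG' ▸ ContinuousLinearMap.differentiableAt _) hy hv, ContinuousLinearMap.fderiv, hG',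
      ContinuousLinearMap.fderiv]
    rfl

end LagrangeMultiplier

section SymmRows

open Module

variable {κ : Type*}

/-- The symmetric matrices whose rows, and hence columns, lie in `L`: the symmetric square
of `L`. -/
def symmRowsIn (L : Submodule ℝ (κ → ℝ)) : Submodule ℝ (Matrix κ κ ℝ) where
  carrier := {M | M.IsSymm ∧ ∀ i, M i ∈ L}
  zero_mem' := ⟨Matrix.isSymm_zero, fun _ => L.zero_mem⟩
  add_mem' hA hB := ⟨hA.1.add hB.1, fun i => L.add_mem (hA.2 i) (hB.2 i)⟩
  smul_mem' r _ hA := ⟨hA.1.smul r, fun i => L.smul_mem r (hA.2 i)⟩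

theorem mem_symmRowsIn {L : Submodule ℝ (κ → ℝ)} {M : Matrix κ κ ℝ} :
    M ∈ symmRowsIn L ↔ M.IsSymm ∧ ∀ i, M i ∈ L := Iff.rfl

theorem symmRowsIn_inf (L L' : Submodule ℝ (κ → ℝ)) :
    symmRowsIn (L ⊓ L') = symmRowsIn L ⊓ symmRowsIn L' := by
  ext M
  simp only [Submodule.mem_inf, mem_symmRowsIn]
  grind

theorem finrank_symmRowsIn_top_le (m : ℕ) :
    2 * finrank ℝ (symmRowsIn (⊤ : Submodule ℝ (Fin m → ℝ))) ≤ m * (m + 1) := by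
  let entries : symmRowsIn (⊤ : Submodule ℝ (Fin m → ℝ)) →ₗ[ℝ] (Sym2 (Fin m) → ℝ) :=
    { toFun M := Sym2.lift ⟨fun i j => M.1 i j, fun i j => M.2.1.apply j i⟩
      map_add' _ _ := funext (Sym2.ind fun _ _ => rfl)
      map_smul' _ _ := funext (Sym2.ind fun _ _ => rfl) }
  have entries_injective : Function.Injective entries := fun M M' h =>
    Subtype.ext (Matrix.ext fun i j => congrFun h s(i, j))
  have hle := LinearMap.finrank_le_finrank_of_injective entries_injective
  rw [finrank_fintype_fun_eq_card, Sym2.card, Fintype.card_fin, Nat.choose_two_right] at hle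
  have := Nat.div_mul_le_self ((m + 1) * (m + 1 - 1)) 2
  rw [Nat.add_sub_cancel] at this hle
  lia

theorem exists_matrix_forall_vecMul_eq_zero [Fintype κ] (L : Submodule ℝ (κ → ℝ)) :
    ∃ Q : Matrix κ (Fin (finrank ℝ L)) ℝ, ∀ x ∈ L, x ᵥ* Q = 0 → x = 0 := by
  classical
  obtain ⟨f, hf⟩ := LinearMap.exists_extend (finBasis ℝ L).equivFun.toLinearMap
  refine ⟨f.toMatrix'ᵀ, fun x hx h => ?_⟩
  rw [Matrix.vecMul_transpose, LinearMap.toMatrix'_mulVec] at h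
  have coords_eq_zero : (finBasis ℝ L).equivFun ⟨x, hx⟩ = 0 :=
    (LinearMap.congr_fun hf ⟨x, hx⟩).symm.trans h
  exact congrArg Subtype.val ((LinearEquiv.map_eq_zero_iff _).1 coords_eq_zero)

theorem two_mul_finrank_symmRowsIn_le [Finite κ] (L : Submodule ℝ (κ → ℝ)) :
    2 * finrank ℝ (symmRowsIn L) ≤ finrank ℝ L * (finrank ℝ L + 1) := by
  cases nonempty_fintype κ
  obtain ⟨Q, hQ⟩ := exists_matrix_forall_vecMul_eq_zero L
  let congruence : Matrix κ κ ℝ →ₗ[ℝ] Matrix _ _ ℝ :=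
    mulRightLinearMap _ ℝ Q ∘ₗ mulLeftLinearMap _ ℝ Qᵀ
  have maps_symm : ∀ M ∈ symmRowsIn L, congruence M ∈ symmRowsIn ⊤ := fun M hM =>
    ⟨by
      change (Qᵀ * M * Q).IsSymm
      rw [Matrix.IsSymm, Matrix.transpose_mul, Matrix.transpose_mul, hM.1.eq,
        Matrix.transpose_transpose, Matrix.mul_assoc], fun _ => trivial⟩
  have injective : Function.Injective (congruence.restrict maps_symm) := by
    refine (injective_iff_map_eq_zero _).2 fun ⟨M, hM⟩ h => Subtype.ext ?_
    have row_mem : ∀ i, (Qᵀ * M) i ∈ L := fun i => by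
      rw [Matrix.mul_apply_eq_vecMul, Matrix.vecMul_eq_sum]
      exact L.sum_mem fun j _ => L.smul_mem _ (hM.2 j)
    have transpose_mul_eq_zero : Qᵀ * M = 0 := funext fun i =>
      hQ _ (row_mem i) (congrFun (congrArg Subtype.val h) i)
    have mul_eq_zero : M * Q = 0 := by
      rw [← Matrix.transpose_eq_zero, Matrix.transpose_mul, hM.1.eq, transpose_mul_eq_zero]
    exact funext fun i => hQ _ (hM.2 i) (congrFun mul_eq_zero i)
  exact (Nat.mul_le_mul_left 2 (LinearMap.finrank_le_finrank_of_injective injective)).trans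
    (finrank_symmRowsIn_top_le _)

end SymmRows

section BlockRelations

open Module Finset

theorem finrank_le_of_map_le {V W : Type*} [AddCommGroup V] [Module ℝ V] [FiniteDimensional ℝ V]
    [AddCommGroup W] [Module ℝ W] [FiniteDimensional ℝ W] {A B : Submodule ℝ V} {D : Submodule ℝ W}
    {f : V →ₗ[ℝ] W} (hmap : A.map f ≤ D) (hker : A ⊓ LinearMap.ker f ≤ B) :
    finrank ℝ A ≤ finrank ℝ D + finrank ℝ B := by
  have hrange : finrank ℝ (LinearMap.range (f.domRestrict A)) ≤ finrank ℝ D := by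
    rw [LinearMap.range_domRestrict]
    exact Submodule.finrank_mono hmap
  have hker : finrank ℝ (LinearMap.ker (f.domRestrict A)) ≤ finrank ℝ B := by
    rw [LinearMap.ker_domRestrict, ← Submodule.finrank_map_subtype_eq,
      Submodule.map_comap_subtype]
    exact Submodule.finrank_mono hker
  rw [← LinearMap.finrank_range_add_finrank_ker (f.domRestrict A)]
  exact add_le_add hrange hker

variable {ι κ β : Type*}

/-- The symmetric matrices that are block diagonal for the partition of the indices into the fibers
of `c`. -/
def symBlockDiag (c : ι → β) : Submodule ℝ (Matrix ι ι ℝ) where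
  carrier := {Λ | Λ.IsSymm ∧ ∀ i j, c i ≠ c j → Λ i j = 0}
  zero_mem' := ⟨Matrix.isSymm_zero, fun _ _ _ => rfl⟩
  add_mem' hA hB := ⟨hA.1.add hB.1, fun i j h => by
    rw [Matrix.add_apply, hA.2 i j h, hB.2 i j h, add_zero]⟩
  smul_mem' r _ hA := ⟨hA.1.smul r, fun i j h => by
    rw [Matrix.smul_apply, hA.2 i j h, smul_zero]⟩

/-- The span of those rows of `Y` whose index lies in one of the blocks in `s`. -/
def blockRowSpan (c : ι → β) (Y : Matrix ι κ ℝ) (s : Finset β) : Submodule ℝ (κ → ℝ) :=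
  Submodule.span ℝ (Y.row '' {i | c i ∈ s})

theorem blockRowSpan_empty (c : ι → β) (Y : Matrix ι κ ℝ) : blockRowSpan c Y ∅ = ⊥ := by
  simp [blockRowSpan]

theorem blockRowSpan_image_univ [Fintype ι] [DecidableEq β] (c : ι → β) (Y : Matrix ι κ ℝ) :
    blockRowSpan c Y (univ.image c) = Submodule.span ℝ (Set.range Y.row) := by
  simp [blockRowSpan]

theorem blockRowSpan_insert [DecidableEq β] (c : ι → β) (Y : Matrix ι κ ℝ) (b : β) (s : Finset β) :
    blockRowSpan c Y (insert b s) = blockRowSpan c Y s ⊔ blockRowSpan c Y {b} := by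
  rw [blockRowSpan, blockRowSpan, blockRowSpan, ← Submodule.span_union, ← Set.image_union]
  congr 2
  ext i
  simp [or_comm]

/-- The operator that keeps the rows with index in the block `b` and zeros out all other rows. -/
def keepBlockRows [DecidableEq β] (c : ι → β) (b : β) : Matrix ι ι ℝ →ₗ[ℝ] Matrix ι ι ℝ where
  toFun Λ := Matrix.of fun i j => if c i = b then Λ i j else 0
  map_add' A B := by
    ext i j
    by_cases h : c i = b <;> simp [h]
  map_smul' r A := by
    ext i j
    by_cases h : c i = b <;> simp [h]

theorem keepBlockRows_apply [DecidableEq β] (c : ι → β) (b : β) (Λ : Matrix ι ι ℝ) (i j : ι) :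
    keepBlockRows c b Λ i j = if c i = b then Λ i j else 0 := rfl

theorem keepBlockRows_mem_symBlockDiag [DecidableEq β] {c : ι → β} {Λ : Matrix ι ι ℝ}
    (hΛ : Λ ∈ symBlockDiag c) (b : β) : keepBlockRows c b Λ ∈ symBlockDiag c := by
  refine ⟨Matrix.IsSymm.ext fun i j => ?_, fun i j hij => ?_⟩
  · by_cases hij : c i = c j
    · rw [keepBlockRows_apply, keepBlockRows_apply, hij, hΛ.1.apply]
    · rw [keepBlockRows_apply, keepBlockRows_apply, hΛ.2 i j hij, hΛ.2 j i (Ne.symm hij), ite_self,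
        ite_self]
  · rw [keepBlockRows_apply, hΛ.2 i j hij, ite_self]

variable [Fintype ι]

theorem finrank_blockRowSpan_le [DecidableEq β] (c : ι → β) (Y : Matrix ι κ ℝ) (b : β) :
    finrank ℝ (blockRowSpan c Y {b}) ≤ #{i | c i = b} := by
  classical
  have hrows : blockRowSpan c Y {b} =
      Submodule.span ℝ (({i | c i = b} : Finset ι).image Y.row : Set (κ → ℝ)) := by
    simp [blockRowSpan]
  rw [hrows]
  exact (finrank_span_finset_le_card _).trans card_image_le

theorem mul_apply_eq_zero_of_row_eq_zero {r : Type*} {Λ : Matrix ι ι ℝ} (hΛ : Λ.IsSymm) {j : ι}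
    (hj : ∀ i, Λ j i = 0) (A : Matrix r ι ℝ) (a : r) : (A * Λ) a j = 0 := by
  rw [Matrix.mul_apply]
  exact Finset.sum_eq_zero fun i _ => by rw [hΛ.apply, hj, mul_zero]

theorem transpose_mul_mul_mem_symmRowsIn {c : ι → β} {s : Finset β} {Λ : Matrix ι ι ℝ}
    (hΛ : Λ.IsSymm) (hs : ∀ i j, c i ∉ s → Λ i j = 0) (Y : Matrix ι κ ℝ) :
    Yᵀ * Λ * Y ∈ symmRowsIn (blockRowSpan c Y s) := by
  refine ⟨?_, fun a => ?_⟩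
  · rw [Matrix.IsSymm, Matrix.transpose_mul, Matrix.transpose_mul, hΛ.eq,
      Matrix.transpose_transpose, Matrix.mul_assoc]
  · rw [Matrix.mul_apply_eq_vecMul, Matrix.vecMul_eq_sum]
    refine Submodule.sum_mem _ fun j _ => ?_
    by_cases hj : c j ∈ s
    · exact Submodule.smul_mem _ _ (Submodule.subset_span ⟨j, hj, rfl⟩)
    · rw [mul_apply_eq_zero_of_row_eq_zero hΛ fun i => hs j i hj, zero_smul]
      exact Submodule.zero_mem _

/-- The linear relations `∑ Λᵢⱼ Yᵢ Yⱼᵀ = 0` between products of rows of `Y` within a common block,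
where only the blocks in `s` occur. -/
def blockRelations (c : ι → β) (Y : Matrix ι κ ℝ) (s : Finset β) : Submodule ℝ (Matrix ι ι ℝ) where
  carrier := {Λ | Λ ∈ symBlockDiag c ∧ (∀ i j, c i ∉ s → Λ i j = 0) ∧ Yᵀ * Λ * Y = 0}
  zero_mem' := ⟨Submodule.zero_mem _, fun _ _ _ => rfl, by rw [Matrix.mul_zero, Matrix.zero_mul]⟩
  add_mem' hA hB := ⟨Submodule.add_mem _ hA.1 hB.1, fun i j h => by
    rw [Matrix.add_apply, hA.2.1 i j h, hB.2.1 i j h, add_zero], by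
    rw [Matrix.mul_add, Matrix.add_mul, hA.2.2, hB.2.2, add_zero]⟩
  smul_mem' r _ hA := ⟨Submodule.smul_mem _ r hA.1, fun i j h => by
    rw [Matrix.smul_apply, hA.2.1 i j h, smul_zero], by
    rw [Matrix.mul_smul, Matrix.smul_mul, hA.2.2, smul_zero]⟩

theorem blockRelations_empty (c : ι → β) (Y : Matrix ι κ ℝ) : blockRelations c Y ∅ = ⊥ :=
  (Submodule.eq_bot_iff _).2 fun _ hΛ => Matrix.ext fun i j => hΛ.2.1 i j (notMem_empty _)

variable [DecidableEq ι] [Fintype κ]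

/-- Within each block of indices, the rows of `Y` are orthonormal. -/
def BlockRowsOrthonormal (c : ι → β) (Y : Matrix ι κ ℝ) : Prop :=
  ∀ i j, c i = c j → (Y * Yᵀ) i j = (1 : Matrix ι ι ℝ) i j

namespace BlockRowsOrthonormal

variable {c : ι → β} {Y : Matrix ι κ ℝ} (hY : BlockRowsOrthonormal c Y)
include hY

theorem mul_mul_transpose_apply {r : Type*} {A : Matrix r ι ℝ} {a : r} {j : ι}
    (hA : ∀ i, c i ≠ c j → A a i = 0) : (A * Y * Yᵀ) a j = A a j := by
  have hterm : ∀ i, A a i * (Y * Yᵀ) i j = A a i * (1 : Matrix ι ι ℝ) i j := fun i => by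
    by_cases hij : c i = c j
    · rw [hY i j hij]
    · rw [hA i hij, zero_mul, zero_mul]
  rw [Matrix.mul_assoc, Matrix.mul_apply, Finset.sum_congr rfl fun i _ => hterm i,
    ← Matrix.mul_apply, Matrix.mul_one]

theorem eq_zero_of_mul_eq_zero {Λ : Matrix ι ι ℝ} (hΛ : Λ ∈ symBlockDiag c) (h : Λ * Y = 0) :
    Λ = 0 := by
  ext i j
  by_cases hij : c i = c j
  · rw [← hY.mul_mul_transpose_apply fun k hk => hΛ.2 i k fun h => hk (h.symm.trans hij), h,
      Matrix.zero_mul]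
  · exact hΛ.2 i j hij

theorem blockRelations_singleton (b : β) : blockRelations c Y {b} = ⊥ := by
  refine (Submodule.eq_bot_iff _).2 fun Λ ⟨hΛ, hsupp, hrel⟩ => hY.eq_zero_of_mul_eq_zero hΛ ?_
  have coeff_eq_zero : ∀ a j, c j ≠ b → (Yᵀ * Λ) a j = 0 := fun a j hj =>
    mul_apply_eq_zero_of_row_eq_zero hΛ.1 (fun i => hsupp j i (by simpa using hj)) _ a
  have transpose_mul_eq_zero : Yᵀ * Λ = 0 := by
    ext a j
    by_cases hj : c j = b
    · rw [← hY.mul_mul_transpose_apply fun i hi => coeff_eq_zero a i (hj ▸ hi), hrel,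
        Matrix.zero_mul]
    · exact coeff_eq_zero a j hj
  rw [← Matrix.transpose_eq_zero, Matrix.transpose_mul, hΛ.1.eq, transpose_mul_eq_zero]

variable [DecidableEq β]

theorem finrank_blockRelations_insert_le (b : β) (s : Finset β) :
    finrank ℝ (blockRelations c Y (insert b s)) ≤
      finrank ℝ (symmRowsIn (blockRowSpan c Y s ⊓ blockRowSpan c Y {b})) +
        finrank ℝ (blockRelations c Y s) := by
  let blockTerm : Matrix ι ι ℝ →ₗ[ℝ] Matrix κ κ ℝ :=
    mulRightLinearMap κ ℝ Y ∘ₗ mulLeftLinearMap ι ℝ Yᵀ ∘ₗ keepBlockRows c b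
  have hsupp_b : ∀ Λ i j, c i ∉ ({b} : Finset β) → keepBlockRows c b Λ i j = 0 :=
    fun Λ i j hi => if_neg (by simpa using hi)
  refine finrank_le_of_map_le (f := blockTerm) ?_ ?_
  · rintro _ ⟨Λ, ⟨hΛ, hsupp, hrel⟩, rfl⟩
    have hΛb := keepBlockRows_mem_symBlockDiag hΛ b
    rw [symmRowsIn_inf]
    refine ⟨?_, transpose_mul_mul_mem_symmRowsIn hΛb.1 (hsupp_b Λ) Y⟩
    have hsupp_s : ∀ i j, c i ∉ s → (Λ - keepBlockRows c b Λ) i j = 0 := fun i j hi => by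
      rw [Matrix.sub_apply, keepBlockRows_apply]
      split_ifs with hb
      · exact sub_self _
      · rw [hsupp i j (by simp [hb, hi]), sub_zero]
    have hmem := transpose_mul_mul_mem_symmRowsIn (hΛ.1.sub hΛb.1) hsupp_s Y
    rwa [Matrix.mul_sub, Matrix.sub_mul, hrel, zero_sub, Submodule.neg_mem_iff] at hmem
  · rintro Λ ⟨⟨hΛ, hsupp, hrel⟩, hker⟩
    have hmem : keepBlockRows c b Λ ∈ blockRelations c Y {b} :=
      ⟨keepBlockRows_mem_symBlockDiag hΛ b, hsupp_b Λ, hker⟩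
    rw [hY.blockRelations_singleton, Submodule.mem_bot] at hmem
    refine ⟨hΛ, fun i j hi => ?_, hrel⟩
    by_cases hb : c i = b
    · simpa [keepBlockRows_apply, hb] using congrFun (congrFun hmem i) j
    · exact hsupp i j (by simp [hb, hi])

theorem two_mul_finrank_blockRelations_add_le {d : ℕ} (hc : ∀ b, #{i | c i = b} ≤ d)
    (s : Finset β) :
    2 * finrank ℝ (blockRelations c Y s) + (d + 1) * finrank ℝ (blockRowSpan c Y s) ≤
      (d + 1) * #{i | c i ∈ s} := by
  induction s using Finset.induction_on with
  | empty => simp [blockRelations_empty, blockRowSpan_empty]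
  | insert b s hb ih =>
    have hcard : #{i | c i ∈ insert b s} = #{i | c i ∈ s} + #{i | c i = b} := by
      rw [← card_union_of_disjoint]
      · congr 1
        ext i
        simp [or_comm]
      · exact disjoint_filter.2 fun i _ his hib => hb (hib ▸ his)
    have hblock := finrank_blockRowSpan_le c Y b
    have hsup :=
      Submodule.finrank_sup_add_finrank_inf_eq (blockRowSpan c Y s) (blockRowSpan c Y {b})
    have hinf : finrank ℝ (blockRowSpan c Y s ⊓ blockRowSpan c Y {b} : Submodule ℝ (κ → ℝ)) ≤ d :=
      (Submodule.finrank_mono inf_le_right).trans (hblock.trans (hc b))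
    have hoverlap : 2 * finrank ℝ (symmRowsIn (blockRowSpan c Y s ⊓ blockRowSpan c Y {b})) ≤
        (d + 1) * finrank ℝ (blockRowSpan c Y s ⊓ blockRowSpan c Y {b} : Submodule ℝ (κ → ℝ)) :=
      (two_mul_finrank_symmRowsIn_le _).trans (by rw [mul_comm]; gcongr)
    have hinsert := hY.finrank_blockRelations_insert_le b s
    rw [hcard, blockRowSpan_insert]
    nlinarith

theorem two_mul_finrank_blockRelations_image_univ_add_le {d : ℕ} (hc : ∀ b, #{i | c i = b} ≤ d) :
    2 * finrank ℝ (blockRelations c Y (univ.image c)) + (d + 1) * Y.rank ≤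
      (d + 1) * Fintype.card ι := by
  have h := hY.two_mul_finrank_blockRelations_add_le hc (univ.image c)
  rw [blockRowSpan_image_univ, ← Matrix.rank_eq_finrank_span_row] at h
  simpa using h

end BlockRowsOrthonormal

end BlockRelations

section TangentDirections

open Module Finset

theorem exists_ne_zero_map_mem_of_finrank_orthogonal_lt {Z E : Type*} [AddCommGroup Z] [Module ℝ Z]
    [FiniteDimensional ℝ Z] [NormedAddCommGroup E] [InnerProductSpace ℝ E] [FiniteDimensional ℝ E]
    (f : Z →ₗ[ℝ] E) {W : Submodule ℝ E} (hW : finrank ℝ Wᗮ < finrank ℝ Z) :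
    ∃ z ≠ 0, f z ∈ W := by
  have hquot : finrank ℝ (E ⧸ W) = finrank ℝ Wᗮ := by
    have := W.finrank_quotient_add_finrank
    have := W.finrank_add_finrank_orthogonal
    lia
  obtain ⟨z, hz, hz0⟩ := Submodule.exists_mem_ne_zero_of_ne_bot
    (LinearMap.ker_ne_bot_of_finrank_lt (f := W.mkQ ∘ₗ f) (hquot ▸ hW))
  exact ⟨z, hz0, (Submodule.Quotient.mk_eq_zero W).1 hz⟩

variable {ι κ β : Type*} [Fintype ι]

theorem mem_orthogonal_symBlockDiag {c : ι → β} {X : Matrix ι ι ℝ} :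
    X ∈ (symBlockDiag c)ᗮ ↔ ∀ i j, c i = c j → X i j + X j i = 0 := by
  classical
  rw [Submodule.mem_orthogonal]
  refine ⟨fun h i j hij => ?_, fun h Λ hΛ => ?_⟩
  · have inner_single : ∀ i j, inner ℝ (Matrix.single i j (1 : ℝ)) X = X i j := fun i j => by
      simp [inner, Matrix.trace_single_mul]
    have hmem : Matrix.single i j (1 : ℝ) + Matrix.single j i 1 ∈ symBlockDiag c := by
      refine ⟨Matrix.transpose_single i j (1 : ℝ) ▸ Matrix.isSymm_add_transpose_self _, ?_⟩
      intro k l hkl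
      simp only [Matrix.add_apply, Matrix.single_apply]
      grind
    rw [← inner_single i j, ← inner_single j i, ← inner_add_left]
    exact h _ hmem
  · have inner_transpose : inner ℝ Λ Xᵀ = inner ℝ Λ X := by
      rw [← frobenius_inner_transpose Λ X, hΛ.1.eq]
    have inner_add_transpose : inner ℝ Λ (X + Xᵀ) = 0 := by
      rw [frobenius_inner_eq_sum]
      refine Finset.sum_eq_zero fun i _ => Finset.sum_eq_zero fun j _ => ?_
      by_cases hij : c i = c j
      · rw [Matrix.add_apply, Matrix.transpose_apply, h i j hij, mul_zero]
      · rw [hΛ.2 i j hij, zero_mul]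
    rw [inner_add_right, inner_transpose] at inner_add_transpose
    linarith

variable [Fintype κ] [DecidableEq β]

theorem orthogonal_sup_range_le_blockRelations (c : ι → β) (Y : Matrix ι κ ℝ) :
    ((symBlockDiag c)ᗮ ⊔
      LinearMap.range (mulRightLinearMap ι ℝ Yᵀ ∘ₗ mulLeftLinearMap κ ℝ Y))ᗮ ≤
      blockRelations c Y (univ.image c) := by
  rw [← Submodule.inf_orthogonal, Submodule.orthogonal_orthogonal]
  rintro Λ ⟨hΛ, hrange⟩
  refine ⟨hΛ, fun i _ hi => absurd (mem_image_of_mem c (mem_univ i)) hi, ?_⟩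
  have horth : inner ℝ (Y * (Yᵀ * Λ * Y) * Yᵀ) Λ = 0 := hrange _ (LinearMap.mem_range_self _ _)
  rwa [frobenius_inner_mul_left, Matrix.transpose_transpose, frobenius_inner_mul_right,
    ← Matrix.mul_assoc, inner_self_eq_zero] at horth

theorem BlockRowsOrthonormal.exists_ne_zero_vecMulVec_sub_mul_mem [DecidableEq ι] {c : ι → β}
    {Y : Matrix ι κ ℝ} (hY : BlockRowsOrthonormal c Y) {d : ℕ} (hc : ∀ b, #{i | c i = b} ≤ d)
    (hd : (d + 1) * Fintype.card ι < (d + 3) * Fintype.card κ) (u : ι → ℝ) :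
    ∃ z ≠ 0, ∃ B : Matrix κ κ ℝ, (Matrix.vecMulVec u z - Y * B) * Yᵀ ∈ (symBlockDiag c)ᗮ := by
  by_cases hrank : Function.Injective Y.mulVecLin
  · let outer : (κ → ℝ) →ₗ[ℝ] Matrix ι ι ℝ :=
      { toFun z := Matrix.vecMulVec u z * Yᵀ
        map_add' _ _ := by rw [Matrix.vecMulVec_add, Matrix.add_mul]
        map_smul' _ _ := by rw [Matrix.vecMulVec_smul, Matrix.smul_mul, RingHom.id_apply] }
    have hrank_eq : Y.rank = Fintype.card κ := by
      rw [Matrix.rank, LinearMap.finrank_range_of_inj hrank, finrank_fintype_fun_eq_card]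
    have hrel := hY.two_mul_finrank_blockRelations_image_univ_add_le hc
    rw [hrank_eq] at hrel
    have hlt : finrank ℝ (blockRelations c Y (univ.image c)) < finrank ℝ (κ → ℝ) := by
      rw [finrank_fintype_fun_eq_card]
      lia
    obtain ⟨z, hz, hmem⟩ := exists_ne_zero_map_mem_of_finrank_orthogonal_lt outer
      ((Submodule.finrank_mono (orthogonal_sup_range_le_blockRelations c Y)).trans_lt hlt)
    obtain ⟨X, hX, _, ⟨B, rfl⟩, hsum⟩ := Submodule.mem_sup.1 hmem
    refine ⟨z, hz, B, ?_⟩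
    rw [Matrix.sub_mul]
    exact eq_sub_of_add_eq hsum ▸ hX
  · rw [injective_iff_map_eq_zero] at hrank
    push Not at hrank
    obtain ⟨z, hYz, hz⟩ := hrank
    refine ⟨z, hz, 0, ?_⟩
    rw [Matrix.mul_zero, sub_zero, Matrix.vecMulVec_mul, Matrix.vecMul_transpose,
      ← Matrix.mulVecLin_apply, hYz, Matrix.vecMulVec_zero]
    exact Submodule.zero_mem _

theorem BlockRowsOrthonormal.posSemidef [DecidableEq ι] {c : ι → β} {Y : Matrix ι κ ℝ}
    (hY : BlockRowsOrthonormal c Y) {d : ℕ} (hc : ∀ b, #{i | c i = b} ≤ d)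
    (hd : (d + 1) * Fintype.card ι < (d + 3) * Fintype.card κ) {S : Matrix ι ι ℝ} (hS : S.IsSymm)
    (hSY : S * Y = 0)
    (hpos : ∀ v : Matrix ι κ ℝ, v * Yᵀ ∈ (symBlockDiag c)ᗮ → 0 ≤ inner ℝ v (S * v)) :
    S.PosSemidef := by
  have hYS : Yᵀ * S = 0 := by rw [← hS, ← Matrix.transpose_mul, hSY, Matrix.transpose_zero]
  refine Matrix.PosSemidef.of_dotProduct_mulVec_nonneg hS fun u => ?_
  obtain ⟨z, hz, B, htangent⟩ := hY.exists_ne_zero_vecMulVec_sub_mul_mem hc hd u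
  have hcurv : 0 ≤ (u ⬝ᵥ S *ᵥ u) * (z ⬝ᵥ z) := by
    have h := hpos _ htangent
    rwa [Matrix.mul_sub, ← Matrix.mul_assoc S Y, hSY, Matrix.zero_mul, sub_zero, inner_sub_left,
      frobenius_inner_mul_right Y B, ← Matrix.mul_assoc, hYS, Matrix.zero_mul, inner_zero_right,
      sub_zero, frobenius_inner_vecMulVec_mul] at h
  rw [star_trivial]
  exact nonneg_of_mul_nonneg_left hcurv (by simpa using Matrix.dotProduct_star_self_pos_iff.2 hz)

end TangentDirections

section Optimality

variable {n p : ℕ} {V β : Type*} [NormedAddCommGroup V] [NormedSpace ℝ V]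

theorem mem_tangentSpaceAt_bmConstraint (𝒜 : Matrix (Fin n) (Fin n) ℝ →ₗ[ℝ] V)
    (y v : Matrix (Fin n) (Fin p) ℝ) :
    v ∈ tangentSpaceAt (bmConstraint p 𝒜) y ↔ 𝒜 (y * vᵀ) + 𝒜 (v * yᵀ) = 0 :=
  mem_tangentSpaceAt_of_quadratic (LinearMap.mk₂ ℝ (fun y v => 𝒜 (y * vᵀ))
    (fun _ _ _ => by rw [Matrix.add_mul, map_add])
    (fun _ _ _ => by rw [Matrix.smul_mul, map_smul])
    (fun _ _ _ => by rw [Matrix.transpose_add, Matrix.mul_add, map_add])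
    (fun _ _ _ => by rw [Matrix.transpose_smul, Matrix.mul_smul, map_smul])) (fun _ => rfl) y v

theorem gradient_bmCost (C : Matrix (Fin n) (Fin n) ℝ) (y : Matrix (Fin n) (Fin p) ℝ) :
    gradient (bmCost p C) y = (C + Cᵀ) * y := by
  rw [Matrix.add_mul]
  exact gradient_of_quadratic (mulLeftLinearMap (Fin p) ℝ C) (mulLeftLinearMap (Fin p) ℝ Cᵀ)
    (frobenius_inner_mul_right C) (fun _ => rfl) y

/-- The linear map `𝒜` prescribes the diagonal blocks of a matrix, for the partition of the indices
into the fibers of `c`, and nothing else. -/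
def IsBlockConstraint (𝒜 : Matrix (Fin n) (Fin n) ℝ →ₗ[ℝ] V) (c : Fin n → β) : Prop :=
  ∀ X, 𝒜 X = 0 ↔ ∀ i j, c i = c j → X i j = 0

theorem isSDPOptimal_of_dual_certificate {𝒜 : Matrix (Fin n) (Fin n) ℝ →ₗ[ℝ] V} {b : V}
    {C Λ X : Matrix (Fin n) (Fin n) ℝ} (hX : X ∈ sdpFeasible 𝒜 b)
    (hΛ : ∀ Z, 𝒜 Z = 0 → inner ℝ Λ Z = 0) (hS : (C + Cᵀ - Λ).PosSemidef)
    (hSX : inner ℝ (C + Cᵀ - Λ) X = 0) : IsSDPOptimal 𝒜 b C X := by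
  refine ⟨hX, fun X' hX' => ?_⟩
  have inner_slack : ∀ Z ∈ sdpFeasible 𝒜 b,
      inner ℝ (C + Cᵀ - Λ) Z = 2 * inner ℝ C Z - inner ℝ Λ Z := fun Z hZ => by
    have hZt : Zᵀ = Z := hZ.2.isHermitian
    have hCt : inner ℝ Cᵀ Z = inner ℝ C Z := by rw [← frobenius_inner_transpose C, hZt]
    rw [inner_sub_left, inner_add_left, hCt, two_mul]
  have inner_multiplier : inner ℝ Λ X' = inner ℝ Λ X := by
    rw [← sub_eq_zero, ← inner_sub_right]
    exact hΛ _ (by rw [map_sub, hX'.1, hX.1, sub_self])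
  have slack_nonneg := frobenius_inner_nonneg_of_posSemidef hS hX'.2
  rw [inner_slack X' hX'] at slack_nonneg
  rw [inner_slack X hX] at hSX
  change inner ℝ C X ≤ inner ℝ C X'
  linarith

theorem isBMOptimal_of_isSDPOptimal {𝒜 : Matrix (Fin n) (Fin n) ℝ →ₗ[ℝ] V} {b : V}
    {C : Matrix (Fin n) (Fin n) ℝ} {Y : Matrix (Fin n) (Fin p) ℝ}
    (h : IsSDPOptimal 𝒜 b C (Y * Yᵀ)) : IsBMOptimal 𝒜 b C Y := by
  refine ⟨h.1.1, fun Z hZ => ?_⟩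
  have hle : inner ℝ C (Y * Yᵀ) ≤ inner ℝ C (Z * Zᵀ) :=
    h.2 ⟨hZ, Matrix.posSemidef_self_mul_conjTranspose Z⟩
  rwa [← frobenius_inner_mul_left, ← frobenius_inner_mul_left] at hle

namespace IsBlockConstraint

variable {𝒜 : Matrix (Fin n) (Fin n) ℝ →ₗ[ℝ] V} {c : Fin n → β} (h𝒜 : IsBlockConstraint 𝒜 c)
include h𝒜

theorem mem_tangentSpaceAt_iff {y v : Matrix (Fin n) (Fin p) ℝ} :
    v ∈ tangentSpaceAt (bmConstraint p 𝒜) y ↔ v * yᵀ ∈ (symBlockDiag c)ᗮ := by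
  have hyv : y * vᵀ = (v * yᵀ)ᵀ := by rw [Matrix.transpose_mul, Matrix.transpose_transpose]
  rw [mem_tangentSpaceAt_bmConstraint, ← map_add, h𝒜, mem_orthogonal_symBlockDiag, hyv]
  exact forall₃_congr fun i j _ => by
    rw [Matrix.add_apply, Matrix.transpose_apply, add_comm]

theorem blockRowsOrthonormal {b : V} (hb : 𝒜 1 = b) {Y : Matrix (Fin n) (Fin p) ℝ}
    (hY : Y ∈ bmFeasible p 𝒜 b) : BlockRowsOrthonormal c Y := by
  have hker : 𝒜 (Y * Yᵀ - 1) = 0 := by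
    rw [map_sub, hb, sub_eq_zero]
    exact hY
  exact fun i j hij => sub_eq_zero.1 ((h𝒜 _).1 hker i j hij)

theorem inner_eq_zero {Λ Z : Matrix (Fin n) (Fin n) ℝ} (hΛ : Λ ∈ symBlockDiag c) (hZ : 𝒜 Z = 0) :
    inner ℝ Λ Z = 0 := by
  refine Submodule.inner_right_of_mem_orthogonal hΛ
    (mem_orthogonal_symBlockDiag.2 fun i j hij => ?_)
  rw [(h𝒜 Z).1 hZ i j hij, (h𝒜 Z).1 hZ j i hij.symm, add_zero]

theorem exists_multiplier {b : V} (hb : 𝒜 1 = b) {C : Matrix (Fin n) (Fin n) ℝ}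
    {Y : Matrix (Fin n) (Fin p) ℝ} (hY : IsSecondOrderCritical 𝒜 b C Y) :
    ∃ Λ ∈ symBlockDiag c, (C + Cᵀ - Λ) * Y = 0 ∧
      ∀ v : Matrix (Fin n) (Fin p) ℝ, v * Yᵀ ∈ (symBlockDiag c)ᗮ →
        0 ≤ inner ℝ v ((C + Cᵀ - Λ) * v) := by
  obtain ⟨hfeas, hgrad, hhess⟩ := hY
  let normal : Matrix (Fin n) (Fin p) ℝ →ₗ[ℝ] symBlockDiag c →ₗ[ℝ] Matrix (Fin n) (Fin p) ℝ :=
    LinearMap.mk₂ ℝ (fun y Λ => Λ.1 * y)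
      (fun _ _ _ => Matrix.mul_add _ _ _)
      (fun _ _ _ => Matrix.mul_smul _ _ _)
      (fun _ _ _ => Matrix.add_mul _ _ _)
      (fun _ _ _ => Matrix.smul_mul _ _ _)
  have mem_tangent_iff : ∀ y v, v ∈ tangentSpaceAt (bmConstraint p 𝒜) y ↔
      ∀ Λ, inner ℝ (normal y Λ) v = 0 := fun y v => by
    rw [h𝒜.mem_tangentSpaceAt_iff, Submodule.mem_orthogonal]
    exact Iff.trans (forall₂_congr fun Λ _ => by rw [← frobenius_inner_mul_left]; rfl)
      Subtype.forall.symm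
  have normal_injective : Function.Injective (normal Y) :=
    (injective_iff_map_eq_zero _).2 fun Λ h =>
      Subtype.ext ((h𝒜.blockRowsOrthonormal hb hfeas).eq_zero_of_mul_eq_zero Λ.2 h)
  obtain ⟨Λ, hΛ, hhess_eq⟩ := exists_multiplier_of_riemannianGrad_eq_zero normal
    (mulLeftLinearMap (Fin p) ℝ (C + Cᵀ)) mem_tangent_iff (gradient_bmCost C) normal_injective hgrad
  refine ⟨Λ, Λ.2, ?_, fun v hv => ?_⟩
  · rw [Matrix.sub_mul]
    exact sub_eq_zero.2 hΛ
  · have hv_tangent := h𝒜.mem_tangentSpaceAt_iff.2 hv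
    rw [Matrix.sub_mul]
    exact (hhess v hv_tangent).trans_eq (hhess_eq v hv_tangent)

end IsBlockConstraint

end Optimality

section Constraints

open Finset

theorem isBlockConstraint_blockDiagPart (n d : ℕ) :
    IsBlockConstraint (blockDiagPart n d) fun i => (i : ℕ) / d := by
  intro X
  simp [← Matrix.ext_iff, blockDiagPart]

theorem blockDiagPart_one (n d : ℕ) : blockDiagPart n d 1 = 1 := by
  ext i j
  rw [blockDiagPart, LinearMap.coe_mk, AddHom.coe_mk, Matrix.of_apply]
  split_ifs with h
  · rfl
  · exact (Matrix.one_apply_ne fun hij => h (by rw [hij])).symm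

theorem card_filter_div_eq_le {n d : ℕ} (hd : d = 0 → n = 0) (b : ℕ) :
    #{i : Fin n | (i : ℕ) / d = b} ≤ d := by
  rcases d.eq_zero_or_pos with rfl | hd_pos
  · obtain rfl := hd rfl
    simp
  calc #{i : Fin n | (i : ℕ) / d = b} ≤ #(Finset.Ico (b * d) (b * d + d)) := by
        refine card_le_card_of_injOn (fun i => (i : ℕ)) (fun i hi => ?_) Fin.val_injective.injOn
        have hib : (i : ℕ) / d = b := by simpa using hi
        rw [Nat.div_eq_iff hd_pos] at hib
        rw [mem_coe, mem_Ico]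
        lia
    _ = d := by rw [Nat.card_Ico, Nat.add_sub_cancel_left]

theorem isBlockConstraint_diagLinearMap (n : ℕ) :
    IsBlockConstraint (Matrix.diagLinearMap (Fin n) ℝ ℝ) (id : Fin n → Fin n) := by
  intro X
  simp [funext_iff]

end Constraints

theorem mainTheorem5_general {n p d : ℕ} {V β : Type*} [NormedAddCommGroup V] [NormedSpace ℝ V]
    [DecidableEq β] {𝒜 : Matrix (Fin n) (Fin n) ℝ →ₗ[ℝ] V} {c : Fin n → β}
    (h𝒜 : IsBlockConstraint 𝒜 c) (hc : ∀ b, Finset.card {i | c i = b} ≤ d)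
    (hp : ((d : ℝ) + 1) / ((d : ℝ) + 3) * n < p) {b : V} (hb : 𝒜 1 = b)
    {C : Matrix (Fin n) (Fin n) ℝ} {Y : Matrix (Fin n) (Fin p) ℝ}
    (hY : IsSecondOrderCritical 𝒜 b C Y) :
    IsBMOptimal 𝒜 b C Y ∧ IsSDPOptimal 𝒜 b C (Y * Yᵀ) := by
  obtain ⟨Λ, hΛ, hSY, hpos⟩ := h𝒜.exists_multiplier hb hY
  have hp' : (d + 1) * Fintype.card (Fin n) < (d + 3) * Fintype.card (Fin p) := by
    rw [div_mul_eq_mul_div, div_lt_iff₀' (by positivity)] at hp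
    simp only [Fintype.card_fin]
    exact_mod_cast hp
  have hS : (C + Cᵀ - Λ).PosSemidef :=
    (h𝒜.blockRowsOrthonormal hb hY.1).posSemidef hc hp'
      ((Matrix.isSymm_add_transpose_self C).sub hΛ.1) hSY hpos
  have hSX : inner ℝ (C + Cᵀ - Λ) (Y * Yᵀ) = 0 := by
    rw [← frobenius_inner_mul_left, hSY, inner_zero_left]
  have hopt : IsSDPOptimal 𝒜 b C (Y * Yᵀ) :=
    isSDPOptimal_of_dual_certificate ⟨hY.1, Matrix.posSemidef_self_mul_conjTranspose Y⟩
      (fun _ => h𝒜.inner_eq_zero hΛ) hS hSX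
  exact ⟨isBMOptimal_of_isSDPOptimal hopt, hopt⟩

theorem mainTheorem5 :
    -- Orthogonal-Cut: constraint `blockDiagPart n d X = I`, with `n = q d`
    (∀ n q d p : ℕ, n = q * d → ((d : ℝ) + 1) / ((d : ℝ) + 3) * (n : ℝ) < (p : ℝ) →
      ∀ C : Matrix (Fin n) (Fin n) ℝ, C.IsSymm →
      ∀ Y : Matrix (Fin n) (Fin p) ℝ,
        IsSecondOrderCritical (blockDiagPart n d) 1 C Y →
        IsBMOptimal (blockDiagPart n d) 1 C Y ∧
        IsSDPOptimal (blockDiagPart n d) 1 C (Y * Y.transpose)) ∧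
    -- Max-Cut: constraint `diag X = (1, …, 1)`
    (∀ n p : ℕ, (n : ℝ) / 2 < (p : ℝ) →
      ∀ C : Matrix (Fin n) (Fin n) ℝ, C.IsSymm →
      ∀ Y : Matrix (Fin n) (Fin p) ℝ,
        IsSecondOrderCritical (Matrix.diagLinearMap (Fin n) ℝ ℝ) 1 C Y →
        IsBMOptimal (Matrix.diagLinearMap (Fin n) ℝ ℝ) 1 C Y ∧
        IsSDPOptimal (Matrix.diagLinearMap (Fin n) ℝ ℝ) 1 C (Y * Y.transpose)) := by
  refine ⟨fun n q d p hn hp C _ Y hY => ?_, fun n p hp C _ Y hY => ?_⟩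
  · exact mainTheorem5_general (isBlockConstraint_blockDiagPart n d)
      (card_filter_div_eq_le fun hd => by rw [hn, hd, mul_zero]) hp (blockDiagPart_one n d) hY
  · refine mainTheorem5_general (d := 1) (isBlockConstraint_diagLinearMap n)
      (fun b => by simp [Finset.filter_eq']) ?_ Matrix.diag_one hY
    norm_num
    linarith
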